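/- For a real $n\times n$ matrix $A$ let $\|A\|_\infty=\max_i\sum_j|A_{ij}|$, let $\Delta_i(A)=|A_{ii}|-\sum_{j\ne i}|A_{ij}|$ be the diagonal dominance of its $i$-th row, and call $A$ diagonally dominant if $\Delta_i(A)\ge 0$ for all $i$. For invertible $A$ let $\kappa_\infty(A)=\|A\|_\infty\|A^{-1}\|_\infty$. Let $n\ge 3$ and let $A$ be a symmetric, diagonally dominant $n\times n$ real matrix with all entries positive, with largest off-diagonal entry $m=\max_{i\ne j}A_{ij}$, smallest entry $\ell=\min_{i,j}A_{ij}$ and largest diagonal dominance $\delta=\max_i\Delta_i(A)$. Then $A$ is invertible and \[ \kappa_\infty(A)\le \frac{(2m(n-1)+\delta)(3n-4)}{2\ell(n-2)(n-1)}. \] In particular, $\kappa_\infty(A)$ is asymptotically bounded above by $3m/\ell$ for large $n$, in the following sense. For fixed real $m,\delta$ and $\ell>0$, the right-hand side tends to $3m/\ell$ as $n\to\infty$. Moreover, for every real $D$ and every $\varepsilon>0$ there is an $N$ such that for all $n\ge N$ and all $n\times n$ matrices $A$ as above with $\delta\le Dm$, \[ \kappa_\infty(A)\le(1+\varepsilon)\,\frac{3m}{\ell}.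 \] -/

import Mathlib

open Filter Topology

noncomputable section DiagDominantDefs

namespace DiagDominant

/-- The diagonal dominance `Δ_i(A) = |A_ii| - ∑_{j ≠ i} |A_ij|` of the `i`-th row of `A`. -/
def diagDominance {n : ℕ} (A : Matrix (Fin n) (Fin n) ℝ) (i : Fin n) : ℝ :=
  |A i i| - ∑ j ∈ Finset.univ.erase i, |A i j|

/-- `A` is (weakly) diagonally dominant. -/
def IsDiagDominant {n : ℕ} (A : Matrix (Fin n) (Fin n) ℝ) : Prop :=
  ∀ i, 0 ≤ diagDominance A i

attribute [local instance] Matrix.linftyOpNormedAddCommGroup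

/-- The norm `‖A‖_∞`, the maximum absolute row sum of `A`, which is the operator norm
for the sup norm on vectors (Mathlib's `Matrix.linftyOp` norm). -/
def normInfty {n : ℕ} (A : Matrix (Fin n) (Fin n) ℝ) : ℝ := ‖A‖

/-- The condition number `κ_∞(A) = ‖A‖_∞ ‖A⁻¹‖_∞` (meaningful for invertible `A`). -/
def condInfty {n : ℕ} (A : Matrix (Fin n) (Fin n) ℝ) : ℝ :=
  normInfty A * normInfty A⁻¹

/-- `A` is a symmetric, diagonally dominant matrix with positive entries, whose largest
off-diagonal entry is `m`, whose smallest entry is `l`, and whose largest diagonal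
dominance is `δ`. -/
structure IsPosSymmDiagDominant {n : ℕ} (A : Matrix (Fin n) (Fin n) ℝ) (m l δ : ℝ) :
    Prop where
  pos : ∀ i j, 0 < A i j
  symm : A.IsSymm
  diagDominant : IsDiagDominant A
  largest_offDiag : IsGreatest {x : ℝ | ∃ i j, i ≠ j ∧ x = A i j} m
  smallest_entry : IsLeast {x : ℝ | ∃ i j, x = A i j} l
  largest_dominance : IsGreatest (Set.range (diagDominance A)) δ

end DiagDominant

end DiagDominantDefs

/-!
The norm of `A` is at most `2m(n-1) + δ` row by row, so everything rests on
`‖A⁻¹‖ ≤ 1 / (c ℓ)` with `c = 2(n-1)(n-2)/(3n-4)`, that is, on the lower bound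
`c ℓ ‖x‖ ≤ ‖A x‖` in the sup norm (`sharpConst_mul_le_of_abs_mulVec_le`).

Write `A = S + B`, where `S = ℓ((n-2) I + 𝟙𝟙ᵀ)`. Then `B` is symmetric, diagonally dominant and
nonnegative off the diagonal, so its bilinear form is a nonnegative combination of the forms
`(y i + y j) * (x i + x j)` and `y i * x i`. Call `y` compatible with `x` if all of these are
nonnegative; then `yᵀ A x ≥ yᵀ S x` (`Compatible.mul_sum_le_sum_mulVec`), whatever `B` is, while
`yᵀ A x ≤ ‖y‖₁ ‖A x‖`. It remains to find, for each `x` with `‖x‖ = 1`, a compatible `y ≠ 0` with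
`yᵀ S x ≥ c ℓ ‖y‖₁` (`exists_compatible`). Up to the sign of `x` the coordinate sum is `-τ ≤ 0`.
If `x i = -1` for some `i`, or if `x i = 1` and `τ` is small, a signed unit vector at `i`
suffices. Otherwise `y` is the sign vector of `x`, cut off at the level `|x i| = max 0 b`,
`b = (c - τ)/(n-2)`, which for `ℓ = 1` is the absolute value above which a negative coordinate of `x`
contributes positively to `yᵀ S x - c ‖y‖₁`.
-/

namespace DiagDominant

/-! ### Bilinear forms of diagonally dominant matrices -/

/-- `y` is compatible with `x` if `yᵀ B x ≥ 0` for each of the matrices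
`B = (eᵢ + eⱼ)(eᵢ + eⱼ)ᵀ` and `B = eᵢ eᵢᵀ`, the generators of the cone of symmetric diagonally
dominant matrices with nonnegative entries. -/
structure Compatible {n : ℕ} (x y : Fin n → ℝ) : Prop where
  pair : ∀ i j, 0 ≤ (y i + y j) * (x i + x j)
  single : ∀ i, 0 ≤ y i * x i

theorem Compatible.neg {n : ℕ} {x y : Fin n → ℝ} (h : Compatible (-x) y) :
    Compatible x (-y) where
  pair i j := by
    have := h.pair i j
    simp only [Pi.neg_apply] at this ⊢
    linarith
  single i := by
    have := h.single i
    simp only [Pi.neg_apply] at this ⊢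
    linarith

/-- Such a `B` is a nonnegative combination of the generators in `Compatible`: the off-diagonal
entries weight the pairs, the surpluses `B i i - ∑ j ≠ i, B i j` weight the single coordinates. -/
theorem Compatible.sum_mulVec_nonneg {n : ℕ} {x y : Fin n → ℝ} (h : Compatible x y)
    {B : Matrix (Fin n) (Fin n) ℝ} (hs : B.IsSymm) (hoff : ∀ i j, i ≠ j → 0 ≤ B i j)
    (hdom : ∀ i, ∑ j ∈ Finset.univ.erase i, B i j ≤ B i i) :
    0 ≤ ∑ i, y i * B.mulVec x i := by
  set C : Fin n → Fin n → ℝ := fun i j => if i = j then 0 else B i j with hC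
  have hCs : ∀ i j, C i j = C j i := by
    intro i j
    simp only [hC, eq_comm (a := i), hs.apply i j]
  have hC0 : ∀ i j, 0 ≤ C i j := by
    intro i j
    by_cases hij : i = j
    · simp [hC, hij]
    · simpa [hC, hij] using hoff i j hij
  have herase : ∀ (f : Fin n → ℝ) i,
      ∑ j, C i j * f j = ∑ j ∈ Finset.univ.erase i, B i j * f j := by
    intro f i
    rw [← Finset.add_sum_erase _ _ (Finset.mem_univ i)]
    simp only [hC, if_true, zero_mul, zero_add]
    refine Finset.sum_congr rfl fun j hj => ?_
    rw [if_neg (Finset.ne_of_mem_erase hj).symm]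
  have hCsum : ∀ i, ∑ j, C i j ≤ B i i := by
    intro i
    have := herase (fun _ => 1) i
    simp only [mul_one] at this
    rw [this]
    exact hdom i
  have hrow : ∀ i, y i * B.mulVec x i =
      y i * x i * (B i i - ∑ j, C i j) + ∑ j, y i * C i j * (x i + x j) := by
    intro i
    have h1 : B.mulVec x i = B i i * x i + ∑ j, C i j * x j := by
      rw [herase x i, Matrix.mulVec, dotProduct]
      exact (Finset.add_sum_erase _ (fun j => B i j * x j) (Finset.mem_univ i)).symm
    have h2 : ∑ j, y i * C i j * (x i + x j) =
        y i * x i * ∑ j, C i j + y i * ∑ j, C i j * x j := by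
      rw [Finset.mul_sum, Finset.mul_sum, ← Finset.sum_add_distrib]
      exact Finset.sum_congr rfl fun j _ => by ring
    rw [h1, h2]
    ring
  -- Averaging with the transposed sum turns `y i` into `(y i + y j) / 2`.
  have hswap : ∑ i, ∑ j, y i * C i j * (x i + x j) = ∑ i, ∑ j, y j * C i j * (x i + x j) := by
    rw [Finset.sum_comm]
    refine Finset.sum_congr rfl fun i _ => Finset.sum_congr rfl fun j _ => ?_
    rw [hCs j i, add_comm (x j)]
  have hpair : 0 ≤ ∑ i, ∑ j, y i * C i j * (x i + x j) := by
    have h2 : 0 ≤ ∑ i, ∑ j, C i j * ((y i + y j) * (x i + x j)) :=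
      Finset.sum_nonneg fun i _ => Finset.sum_nonneg fun j _ => mul_nonneg (hC0 i j) (h.pair i j)
    have h3 : ∑ i, ∑ j, C i j * ((y i + y j) * (x i + x j)) =
        ∑ i, ∑ j, y i * C i j * (x i + x j) + ∑ i, ∑ j, y j * C i j * (x i + x j) := by
      simp only [← Finset.sum_add_distrib]
      exact Finset.sum_congr rfl fun i _ => Finset.sum_congr rfl fun j _ => by ring
    linarith
  rw [Finset.sum_congr rfl fun i _ => hrow i, Finset.sum_add_distrib]
  exact add_nonneg (Finset.sum_nonneg fun i _ =>
    mul_nonneg (h.single i) (sub_nonneg.2 (hCsum i))) hpair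

/-- On compatible pairs the form of `A` dominates that of `S = ℓ((n-2) I + 𝟙𝟙ᵀ)`. -/
theorem Compatible.mul_sum_le_sum_mulVec {n : ℕ} {x y : Fin n → ℝ} (h : Compatible x y)
    {A : Matrix (Fin n) (Fin n) ℝ} {l : ℝ} (hl : 0 ≤ l) (hs : A.IsSymm)
    (hle : ∀ i j, l ≤ A i j) (hdom : IsDiagDominant A) :
    l * ∑ i, y i * (((n : ℝ) - 2) * x i + ∑ j, x j) ≤ ∑ i, y i * A.mulVec x i := by
  obtain ⟨S, hS⟩ : ∃ S : Matrix (Fin n) (Fin n) ℝ,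
      ∀ i j, S i j = (if i = j then l * ((n : ℝ) - 2) else 0) + l := ⟨_, fun _ _ => rfl⟩
  have hSx : ∀ i, S.mulVec x i = l * (((n : ℝ) - 2) * x i + ∑ j, x j) := by
    intro i
    simp only [hS, Matrix.mulVec, dotProduct, add_mul, Finset.sum_add_distrib, ite_mul, zero_mul,
      Finset.sum_ite_eq, Finset.mem_univ, if_true, ← Finset.mul_sum]
    ring
  have hB := h.sum_mulVec_nonneg (B := A - S)
    (by
      ext i j
      simp only [Matrix.transpose_apply, Matrix.sub_apply, hS, hs.apply i j, eq_comm (a := j)])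
    (by
      intro i j hij
      rw [Matrix.sub_apply, hS, if_neg hij]
      linarith [hle i j])
    (by
      intro i
      have h1 : ∑ j ∈ Finset.univ.erase i, (A - S) i j =
          ∑ j ∈ Finset.univ.erase i, |A i j| - ((n : ℝ) - 1) * l := by
        have h2 : ∀ j ∈ Finset.univ.erase i, (A - S) i j = |A i j| - l := by
          intro j hj
          rw [abs_of_nonneg (hl.trans (hle i j))]
          simp [hS, (Finset.ne_of_mem_erase hj).symm]
        have hn : 1 ≤ n := i.pos
        rw [Finset.sum_congr rfl h2, Finset.sum_sub_distrib, Finset.sum_const,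
          Finset.card_erase_of_mem (Finset.mem_univ i), Finset.card_univ, Fintype.card_fin,
          nsmul_eq_mul, Nat.cast_sub hn, Nat.cast_one]
      have h3 := hdom i
      rw [diagDominance, abs_of_nonneg (hl.trans (hle i i))] at h3
      rw [h1]
      simp only [Matrix.sub_apply, hS, if_true]
      linarith)
  have : ∑ i, y i * (A - S).mulVec x i =
      ∑ i, y i * A.mulVec x i - l * ∑ i, y i * (((n : ℝ) - 2) * x i + ∑ j, x j) := by
    rw [Finset.mul_sum, ← Finset.sum_sub_distrib]
    refine Finset.sum_congr rfl fun i _ => ?_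
    rw [Matrix.sub_mulVec, Pi.sub_apply, hSx]
    ring
  linarith

/-! ### Compatible test vectors -/

/-- The reciprocal of `‖S⁻¹‖_∞` for `S = (n-2) I + 𝟙𝟙ᵀ`, when `n ≥ 3`. -/
noncomputable def sharpConst (n : ℕ) : ℝ := 2 * ((n : ℝ) - 1) * ((n : ℝ) - 2) / (3 * (n : ℝ) - 4)

theorem sharpConst_mul {n : ℕ} (hn : 3 ≤ n) :
    sharpConst n * (3 * (n : ℝ) - 4) = 2 * ((n : ℝ) - 1) * ((n : ℝ) - 2) := by
  have h3 : (3 : ℝ) ≤ n := by exact_mod_cast hn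
  exact div_mul_cancel₀ _ (by linarith)

theorem sharpConst_pos {n : ℕ} (hn : 3 ≤ n) : 0 < sharpConst n := by
  have h3 : (3 : ℝ) ≤ n := by exact_mod_cast hn
  exact div_pos (mul_pos (by linarith) (by linarith)) (by linarith)

theorem sharpConst_le {n : ℕ} (hn : 3 ≤ n) : sharpConst n ≤ (n : ℝ) - 2 := by
  have h3 : (3 : ℝ) ≤ n := by exact_mod_cast hn
  rw [sharpConst, div_le_iff₀ (by linarith)]
  nlinarith

/-- The sign vector of `x` truncated to the coordinates with `t < |x i|`. -/
noncomputable def cutSign {n : ℕ} (t : ℝ) (x : Fin n → ℝ) (i : Fin n) : ℝ :=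
  if t < x i then 1 else if x i < -t then -1 else 0

theorem compatible_cutSign {n : ℕ} {t : ℝ} (ht : 0 ≤ t) (x : Fin n → ℝ) :
    Compatible x (cutSign t x) where
  pair i j := by
    unfold cutSign
    split_ifs <;> nlinarith
  single i := by
    unfold cutSign
    split_ifs <;> nlinarith

/-- A maximal coordinate in absolute value gives a compatible signed unit vector. -/
theorem compatible_single {n : ℕ} {x : Fin n → ℝ} (hx : ∀ i, |x i| ≤ 1) {i : Fin n} {s : ℝ}
    (hi : x i = s) (hs : s = 1 ∨ s = -1) : Compatible x (Pi.single i s) where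
  pair j k := by
    have hj := abs_le.1 (hx j)
    have hk := abs_le.1 (hx k)
    by_cases hji : j = i <;> by_cases hki : k = i <;> rcases hs with rfl | rfl <;>
      simp [hji, hki, hi] <;> linarith
  single j := by
    by_cases hji : j = i
    · subst hji
      rw [Pi.single_eq_same, hi]
      exact mul_self_nonneg s
    · simp [hji]

/-- The truncation level `b = (c - τ)/(n-2)` when it is nonnegative. -/
theorem sharpConst_mul_sum_abs_cutSign_le_of_le {n : ℕ} (hn : 3 ≤ n) {x : Fin n → ℝ}
    (hx : ∀ i, |x i| ≤ 1) {k : Fin n} (hk : x k = 1) {τ : ℝ} (hτ : ∑ i, x i = -τ)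
    (hg : (n : ℝ) - 2 - sharpConst n < τ) (hc : τ ≤ sharpConst n) {b : ℝ}
    (hb : b * ((n : ℝ) - 2) = sharpConst n - τ) :
    sharpConst n * ∑ i, |cutSign b x i| ≤
      ∑ i, cutSign b x i * (((n : ℝ) - 2) * x i + ∑ j, x j) := by
  have h3 : (3 : ℝ) ≤ n := by exact_mod_cast hn
  have hcpos := sharpConst_pos hn
  have hcle := sharpConst_le hn
  have hcmul := sharpConst_mul hn
  set c := sharpConst n
  set N : ℝ := (n : ℝ) - 2 with hN
  have hN1 : 1 ≤ N := by linarith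
  have hb0 : 0 ≤ b := by
    by_contra hneg
    nlinarith
  have hb1 : b < 1 := by
    by_contra hneg
    nlinarith
  set P := Finset.univ.filter fun i => b < x i with hP
  have hkP : k ∈ P := by simp [hP, hk, hb1]
  set p : ℝ := (P.card : ℝ) with hp
  have hp1 : 1 ≤ p := by
    have := Finset.card_pos.2 ⟨k, hkP⟩
    rw [hp]
    exact_mod_cast this
  -- The coordinates above `b`, one of which is `1`, have sum at least `1 + (p - 1) b`.
  have hsumP : 1 + (p - 1) * b ≤ ∑ i ∈ P, x i := by
    have h1 : ∑ i ∈ P.erase k, b ≤ ∑ i ∈ P.erase k, x i :=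
      Finset.sum_le_sum fun i hi => (Finset.mem_filter.1 (Finset.mem_of_mem_erase hi)).2.le
    rw [Finset.sum_const, nsmul_eq_mul, Finset.card_erase_of_mem hkP,
      Nat.cast_sub (Finset.card_pos.2 ⟨k, hkP⟩), Nat.cast_one] at h1
    rw [← Finset.add_sum_erase _ _ hkP, hk]
    linarith
  -- As the total is `-τ`, at most half of the coordinates exceed `b`.
  have hhalf : 2 * p ≤ n := by
    have h1 : ∑ i, (if b < x i then x i + 1 else 0) ≤ ∑ i, (x i + 1) := by
      refine Finset.sum_le_sum fun i _ => ?_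
      have := abs_le.1 (hx i)
      split_ifs <;> linarith
    rw [← Finset.sum_filter, Finset.sum_add_distrib, Finset.sum_add_distrib, hτ] at h1
    simp only [Finset.sum_const, nsmul_eq_mul, mul_one, Finset.card_univ, Fintype.card_fin] at h1
    have h2 : τ + 1 + (p - 1) * b + p ≤ n := by linarith
    have h4 : (τ + 1 + (p - 1) * b + p) * N ≤ n * N := mul_le_mul_of_nonneg_right h2 (by linarith)
    by_contra hcon
    have h5 : (p - 1) * (b * N) = (p - 1) * (c - τ) := by rw [hb]
    by_cases hpn : p ≤ (n : ℝ) - 1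
    · have h6 : 0 ≤ ((n : ℝ) - 1 - p) * (τ - (N - c)) :=
        mul_nonneg (by linarith) (by linarith)
      have h7 : 0 < (2 * p - n) * c := mul_pos (by linarith) hcpos
      nlinarith
    · nlinarith [mul_nonneg (sub_nonneg.2 hp1) hb0]
  have hpoint : ∀ i, (-N * x i - N * b) + (if b < x i then 2 * N * x i - 2 * τ else 0) ≤
      cutSign b x i * (N * x i + ∑ j, x j) - c * |cutSign b x i| := by
    intro i
    rw [hτ]
    unfold cutSign
    split_ifs with h1 h2
    · simp only [abs_one]
      linarith
    · simp only [abs_neg, abs_one]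
      linarith
    · simp only [abs_zero]
      nlinarith
  have hsum := Finset.sum_le_sum fun i (_ : i ∈ Finset.univ) => hpoint i
  have hright : ∑ i, (cutSign b x i * (N * x i + ∑ j, x j) - c * |cutSign b x i|) =
      ∑ i, cutSign b x i * (N * x i + ∑ j, x j) - c * ∑ i, |cutSign b x i| := by
    rw [Finset.sum_sub_distrib, Finset.mul_sum]
  have hleft : ∑ i, ((-N * x i - N * b) + (if b < x i then 2 * N * x i - 2 * τ else 0)) =
      N * τ - n * (N * b) + (2 * N * ∑ i ∈ P, x i - p * (2 * τ)) := by
    rw [Finset.sum_add_distrib, ← Finset.sum_filter, ← hP, Finset.sum_sub_distrib,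
      Finset.sum_sub_distrib, ← Finset.mul_sum, ← Finset.mul_sum P, hτ, Finset.sum_const,
      Finset.sum_const, nsmul_eq_mul, nsmul_eq_mul, Finset.card_univ, Fintype.card_fin, ← hp]
    ring
  rw [hright, hleft] at hsum
  have h8 : 2 * N * (1 + (p - 1) * b) ≤ 2 * N * ∑ i ∈ P, x i :=
    mul_le_mul_of_nonneg_left hsumP (by linarith)
  have h9 : (p - 1) * (b * N) = (p - 1) * (c - τ) := by rw [hb]
  have h10 : (n : ℝ) * (N * b) = n * (c - τ) := by rw [mul_comm N, hb]
  -- After these substitutions the difference of the two sides is at least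
  -- `2 (τ - (N - c)) (n - 2p) + 2 (p - 1) (c - 2(N - c))`, and both products are nonnegative.
  have h11 : 0 ≤ (τ - (N - c)) * (n - 2 * p) := mul_nonneg (by linarith) (by linarith)
  have h12 : 0 ≤ (p - 1) * (c - 2 * (N - c)) := by
    refine mul_nonneg (by linarith) ?_
    have : c * (3 * (n : ℝ) - 4) * 3 ≥ 2 * N * (3 * (n : ℝ) - 4) := by
      rw [hcmul]
      nlinarith
    nlinarith
  have hn2 : (n : ℝ) = N + 2 := by linarith
  rw [hn2] at hcmul hsum h10 h11
  linarith

/-- The truncation level `0`, used when `(c - τ)/(n-2)` is negative. -/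
theorem sharpConst_mul_sum_abs_cutSign_zero_le {n : ℕ} (hn : 3 ≤ n) {x : Fin n → ℝ}
    (hx : ∀ i, |x i| ≤ 1) {k : Fin n} (hk : x k = 1) {τ : ℝ} (hτ : ∑ i, x i = -τ)
    (hc : sharpConst n < τ) :
    sharpConst n * ∑ i, |cutSign 0 x i| ≤
      ∑ i, cutSign 0 x i * (((n : ℝ) - 2) * x i + ∑ j, x j) := by
  have h3 : (3 : ℝ) ≤ n := by exact_mod_cast hn
  have hcpos := sharpConst_pos hn
  have hcle := sharpConst_le hn
  have hcmul := sharpConst_mul hn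
  set c := sharpConst n
  set N : ℝ := (n : ℝ) - 2 with hN
  set P := Finset.univ.filter fun i => 0 < x i with hP
  set Q := Finset.univ.filter fun i => x i < 0 with hQ
  have hkP : k ∈ P := by simp [hP, hk]
  have hsumP : 1 ≤ ∑ i ∈ P, x i := by
    rw [← hk]
    exact Finset.single_le_sum (f := x) (fun i hi => (Finset.mem_filter.1 hi).2.le) hkP
  have hPQ : P.card + Q.card ≤ n := by
    rw [← Finset.card_union_of_disjoint]
    · exact (Finset.card_le_univ _).trans_eq (Fintype.card_fin n)
    · rw [Finset.disjoint_left]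
      intro i hi hi'
      exact lt_asymm (Finset.mem_filter.1 hi).2 (Finset.mem_filter.1 hi').2
  have hQτ : τ + 1 ≤ Q.card := by
    have h1 : ∑ i, ((if 0 < x i then x i else 0) - (if x i < 0 then (1 : ℝ) else 0)) ≤
        ∑ i, x i := by
      refine Finset.sum_le_sum fun i _ => ?_
      have := abs_le.1 (hx i)
      split_ifs <;> linarith
    rw [Finset.sum_sub_distrib, ← Finset.sum_filter, ← Finset.sum_filter, hτ] at h1
    simp only [Finset.sum_const, nsmul_eq_mul, mul_one] at h1
    linarith
  -- `2c + 2 ≥ n`, so the negative coordinates form a majority.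
  have hmaj : P.card + 1 ≤ Q.card := by
    have h1 : (n : ℝ) ≤ 2 * c + 2 := by
      by_contra hcon
      nlinarith
    have h2 : (n : ℝ) < 2 * Q.card := by linarith
    have h4 : n < 2 * Q.card := by exact_mod_cast h2
    omega
  have hpq : (P.card : ℝ) + Q.card ≤ n := by exact_mod_cast hPQ
  have hmajR : (P.card : ℝ) + 1 ≤ Q.card := by exact_mod_cast hmaj
  have hpoint : ∀ i, -N * x i + (if x i < 0 then τ - c else 0) +
      (if 0 < x i then 2 * N * x i - (τ + c) else 0) ≤
      cutSign 0 x i * (N * x i + ∑ j, x j) - c * |cutSign 0 x i| := by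
    intro i
    rw [hτ]
    unfold cutSign
    rcases lt_trichotomy (x i) 0 with h | h | h
    · simp only [h, if_true, neg_zero, not_lt.2 h.le, if_false, abs_neg, abs_one]
      linarith
    · simp [h]
    · simp only [h, if_true, not_lt.2 h.le, if_false, abs_one]
      linarith
  have hsum := Finset.sum_le_sum fun i (_ : i ∈ Finset.univ) => hpoint i
  have hright : ∑ i, (cutSign 0 x i * (N * x i + ∑ j, x j) - c * |cutSign 0 x i|) =
      ∑ i, cutSign 0 x i * (N * x i + ∑ j, x j) - c * ∑ i, |cutSign 0 x i| := by
    rw [Finset.sum_sub_distrib, Finset.mul_sum]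
  have hleft : ∑ i, (-N * x i + (if x i < 0 then τ - c else 0) +
      (if 0 < x i then 2 * N * x i - (τ + c) else 0)) =
      N * τ + Q.card * (τ - c) + (2 * N * ∑ i ∈ P, x i - P.card * (τ + c)) := by
    rw [Finset.sum_add_distrib, Finset.sum_add_distrib, ← Finset.sum_filter,
      ← Finset.sum_filter, ← hP, ← hQ, Finset.sum_sub_distrib (s := P), ← Finset.mul_sum,
      ← Finset.mul_sum P, hτ, Finset.sum_const, Finset.sum_const, nsmul_eq_mul, nsmul_eq_mul]
    ring
  rw [hright, hleft] at hsum
  have h8 : 2 * N * 1 ≤ 2 * N * ∑ i ∈ P, x i :=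
    mul_le_mul_of_nonneg_left hsumP (by linarith)
  have h9 : 0 ≤ ((Q.card : ℝ) - P.card - 1) * τ := mul_nonneg (by linarith) (by linarith)
  have h10 : 0 ≤ (n - ((P.card : ℝ) + Q.card)) * c := mul_nonneg (by linarith) hcpos.le
  have h11 : 0 ≤ (N + 1) * (τ - c) := mul_nonneg (by linarith) (by linarith)
  have hn2 : (n : ℝ) = N + 2 := by linarith
  rw [hn2] at h10
  linarith

theorem exists_compatible_of_sum_nonpos {n : ℕ} (hn : 3 ≤ n) {x : Fin n → ℝ}
    (hx : ∀ i, |x i| ≤ 1) {k : Fin n} (hk : |x k| = 1) (hσ : ∑ i, x i ≤ 0) :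
    ∃ y : Fin n → ℝ, Compatible x y ∧ y ≠ 0 ∧
      sharpConst n * ∑ i, |y i| ≤ ∑ i, y i * (((n : ℝ) - 2) * x i + ∑ j, x j) := by
  have h3 : (3 : ℝ) ≤ n := by exact_mod_cast hn
  have hcle := sharpConst_le hn
  obtain ⟨τ, hτ⟩ : ∃ τ, ∑ i, x i = -τ := ⟨-∑ i, x i, by simp⟩
  have hsingle : ∀ s : ℝ, x k = s → (s = 1 ∨ s = -1) →
      sharpConst n ≤ s * (((n : ℝ) - 2) * s - τ) →
      ∃ y : Fin n → ℝ, Compatible x y ∧ y ≠ 0 ∧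
        sharpConst n * ∑ i, |y i| ≤ ∑ i, y i * (((n : ℝ) - 2) * x i + ∑ j, x j) := by
    intro s hks hs hle
    have habs : |s| = 1 := by rcases hs with rfl | rfl <;> simp
    refine ⟨Pi.single k s, compatible_single hx hks hs, ?_, ?_⟩
    · rw [Ne, Pi.single_eq_zero_iff]
      rintro rfl
      simp at habs
    · have h1 : ∑ i, |(Pi.single k s : Fin n → ℝ) i| = 1 := by
        rw [Finset.sum_eq_single k]
        · simpa using habs
        · intro j _ hj
          simp [hj]
        · simp
      have h2 : ∑ i, (Pi.single k s : Fin n → ℝ) i * (((n : ℝ) - 2) * x i + ∑ j, x j) =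
          s * (((n : ℝ) - 2) * s - τ) := by
        rw [Finset.sum_eq_single k]
        · rw [Pi.single_eq_same, hks, hτ]
          ring
        · intro j _ hj
          simp [hj]
        · simp
      rw [h1, h2, mul_one]
      exact hle
  rcases eq_or_eq_neg_of_abs_eq hk with hk1 | hk1
  · by_cases hg : τ ≤ (n : ℝ) - 2 - sharpConst n
    · exact hsingle 1 hk1 (Or.inl rfl) (by linarith)
    · push Not at hg
      have hne : ∀ t, t < 1 → cutSign t x ≠ 0 := by
        intro t ht h0
        have := congrFun h0 k
        simp [cutSign, hk1, ht] at this
      rcases le_or_gt τ (sharpConst n) with hc | hc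
      · have hb : (sharpConst n - τ) / ((n : ℝ) - 2) * ((n : ℝ) - 2) = sharpConst n - τ :=
          div_mul_cancel₀ _ (by linarith)
        refine ⟨_, compatible_cutSign (div_nonneg (by linarith) (by linarith)) x, hne _ ?_,
          sharpConst_mul_sum_abs_cutSign_le_of_le hn hx hk1 hτ hg hc hb⟩
        rw [div_lt_one (by linarith)]
        linarith
      · exact ⟨_, compatible_cutSign le_rfl x, hne _ one_pos,
          sharpConst_mul_sum_abs_cutSign_zero_le hn hx hk1 hτ hc⟩
  · exact hsingle (-1) hk1 (Or.inr rfl) (by linarith)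

/-- The extremal problem behind the sharp constant: every `x` of sup norm `1` has a nonzero
compatible `y` with `yᵀ((n-2) I + 𝟙𝟙ᵀ)x ≥ c ‖y‖₁`. -/
theorem exists_compatible {n : ℕ} (hn : 3 ≤ n) {x : Fin n → ℝ}
    (hx : ∀ i, |x i| ≤ 1) {k : Fin n} (hk : |x k| = 1) :
    ∃ y : Fin n → ℝ, Compatible x y ∧ y ≠ 0 ∧
      sharpConst n * ∑ i, |y i| ≤ ∑ i, y i * (((n : ℝ) - 2) * x i + ∑ j, x j) := by
  rcases le_total (∑ i, x i) 0 with h | h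
  · exact exists_compatible_of_sum_nonpos hn hx hk h
  · obtain ⟨y, hy, hy0, hle⟩ := exists_compatible_of_sum_nonpos (x := -x) hn
      (fun i => by simpa using hx i) (k := k) (by simpa using hk) (by simpa using h)
    refine ⟨-y, hy.neg, neg_ne_zero.2 hy0, ?_⟩
    have h1 : ∑ i, (-y) i * (((n : ℝ) - 2) * x i + ∑ j, x j) =
        ∑ i, y i * (((n : ℝ) - 2) * (-x) i + ∑ j, (-x) j) := by
      refine Finset.sum_congr rfl fun i _ => ?_
      simp only [Pi.neg_apply, Finset.sum_neg_distrib]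
      ring
    rw [h1]
    simpa using hle

/-! ### The norm of the inverse -/

/-- The lower bound `c ℓ ‖x‖ ≤ ‖A x‖` in the sup norm. -/
theorem sharpConst_mul_le_of_abs_mulVec_le {n : ℕ} (hn : 3 ≤ n) {A : Matrix (Fin n) (Fin n) ℝ}
    {l : ℝ} (hl : 0 ≤ l) (hs : A.IsSymm) (hle : ∀ i j, l ≤ A i j) (hdom : IsDiagDominant A)
    (x : Fin n → ℝ) : sharpConst n * l * ‖x‖ ≤ ‖A.mulVec x‖ := by
  rcases eq_or_ne x 0 with rfl | hx0
  · simp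
  have hxpos : 0 < ‖x‖ := norm_pos_iff.2 hx0
  set z : Fin n → ℝ := ‖x‖⁻¹ • x with hz
  have hz1 : ‖z‖ = 1 := by
    rw [hz, norm_smul, norm_inv, norm_norm, inv_mul_cancel₀ hxpos.ne']
  have hne : Nonempty (Fin n) := ⟨⟨0, by omega⟩⟩
  obtain ⟨k, hk⟩ : ∃ k, |z k| = 1 := by
    obtain ⟨k, hk⟩ := Finite.exists_max fun i => |z i|
    refine ⟨k, le_antisymm (by simpa [hz1] using norm_le_pi_norm z k) ?_⟩
    rw [← hz1]
    exact (pi_norm_le_iff_of_nonneg (abs_nonneg _)).2 hk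
  obtain ⟨y, hy, hy0, hyle⟩ := exists_compatible hn
    (fun i => by simpa [hz1] using norm_le_pi_norm z i) hk
  have hypos : 0 < ∑ i, |y i| := by
    obtain ⟨i, hi⟩ := Function.ne_iff.1 hy0
    exact Finset.sum_pos' (fun i _ => abs_nonneg _) ⟨i, Finset.mem_univ i, abs_pos.2 hi⟩
  have h1 := hy.mul_sum_le_sum_mulVec hl hs hle hdom
  have h2 : ∑ i, y i * A.mulVec z i ≤ (∑ i, |y i|) * ‖A.mulVec z‖ := by
    rw [Finset.sum_mul]
    refine Finset.sum_le_sum fun i _ => (le_abs_self _).trans ?_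
    rw [abs_mul]
    exact mul_le_mul_of_nonneg_left (norm_le_pi_norm (A.mulVec z) i) (abs_nonneg _)
  have h3 : sharpConst n * l ≤ ‖A.mulVec z‖ := by
    have h4 := mul_le_mul_of_nonneg_left hyle hl
    refine le_of_mul_le_mul_left ?_ hypos
    linarith
  rw [hz, Matrix.mulVec_smul, norm_smul, norm_inv, norm_norm, inv_mul_eq_div,
    le_div_iff₀ hxpos] at h3
  exact h3

theorem isUnit_of_mul_norm_le {n : ℕ} {A : Matrix (Fin n) (Fin n) ℝ} {c : ℝ} (hc : 0 < c)
    (h : ∀ x, c * ‖x‖ ≤ ‖A.mulVec x‖) : IsUnit A := by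
  rw [← Matrix.mulVec_injective_iff_isUnit]
  intro x y hxy
  have h1 := h (x - y)
  rw [Matrix.mulVec_sub, sub_eq_zero.2 hxy, norm_zero] at h1
  have h2 : ‖x - y‖ ≤ 0 := by
    by_contra hcon
    nlinarith
  exact sub_eq_zero.1 (norm_le_zero_iff.1 h2)

theorem normInfty_inv_le {n : ℕ} {A : Matrix (Fin n) (Fin n) ℝ} {c : ℝ} (hc : 0 < c)
    (h : ∀ x, c * ‖x‖ ≤ ‖A.mulVec x‖) : normInfty A⁻¹ ≤ 1 / c := by
  have hA := isUnit_of_mul_norm_le hc h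
  rw [normInfty, Matrix.linfty_opNorm_eq_opNorm]
  refine ContinuousLinearMap.opNorm_le_bound _ (by positivity) fun x => ?_
  have h1 := h (A⁻¹.mulVec x)
  rw [Matrix.mulVec_mulVec, Matrix.mul_nonsing_inv _ ((Matrix.isUnit_iff_isUnit_det A).1 hA),
    Matrix.one_mulVec] at h1
  change ‖A⁻¹.mulVec x‖ ≤ _
  rw [one_div, inv_mul_eq_div, le_div_iff₀ hc]
  linarith

theorem normInfty_le_of_row_le {n : ℕ} {A : Matrix (Fin n) (Fin n) ℝ} {r : ℝ} (hr : 0 ≤ r)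
    (h : ∀ i, ∑ j, |A i j| ≤ r) : normInfty A ≤ r := by
  rw [normInfty, Matrix.linfty_opNorm_def]
  lift r to NNReal using hr
  rw [NNReal.coe_le_coe]
  refine Finset.sup_le fun i _ => ?_
  rw [← NNReal.coe_le_coe]
  push_cast
  exact h i

theorem normInfty_nonneg {n : ℕ} (A : Matrix (Fin n) (Fin n) ℝ) : 0 ≤ normInfty A := by
  rw [normInfty, Matrix.linfty_opNorm_def]
  exact NNReal.coe_nonneg _

/-! ### The condition number -/

namespace IsPosSymmDiagDominant

variable {n : ℕ} {A : Matrix (Fin n) (Fin n) ℝ} {m l δ : ℝ}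

theorem smallest_pos (h : IsPosSymmDiagDominant A m l δ) : 0 < l := by
  obtain ⟨i, j, hij⟩ := h.smallest_entry.1
  exact hij ▸ h.pos i j

theorem largest_pos (h : IsPosSymmDiagDominant A m l δ) : 0 < m := by
  obtain ⟨i, j, -, hij⟩ := h.largest_offDiag.1
  exact hij ▸ h.pos i j

theorem dominance_nonneg (h : IsPosSymmDiagDominant A m l δ) : 0 ≤ δ := by
  obtain ⟨i, hi⟩ := h.largest_dominance.1
  exact hi ▸ h.diagDominant i

theorem normInfty_le (h : IsPosSymmDiagDominant A m l δ) (hn : 1 ≤ n) :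
    normInfty A ≤ 2 * m * ((n : ℝ) - 1) + δ := by
  have hn' : (1 : ℝ) ≤ n := by exact_mod_cast hn
  have hm := h.largest_pos
  refine normInfty_le_of_row_le
    (add_nonneg (mul_nonneg (by linarith) (by linarith)) h.dominance_nonneg) fun i => ?_
  have h1 : diagDominance A i ≤ δ := h.largest_dominance.2 ⟨i, rfl⟩
  have h2 : ∑ j ∈ Finset.univ.erase i, |A i j| ≤ ((n : ℝ) - 1) * m := by
    have h3 : ∀ j ∈ Finset.univ.erase i, |A i j| ≤ m := by
      intro j hj
      rw [abs_of_pos (h.pos i j)]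
      exact h.largest_offDiag.2 ⟨i, j, (Finset.ne_of_mem_erase hj).symm, rfl⟩
    refine (Finset.sum_le_card_nsmul _ _ _ h3).trans_eq ?_
    rw [Finset.card_erase_of_mem (Finset.mem_univ i), Finset.card_univ, Fintype.card_fin,
      nsmul_eq_mul, Nat.cast_sub hn, Nat.cast_one]
  rw [← Finset.add_sum_erase _ _ (Finset.mem_univ i)]
  rw [diagDominance] at h1
  linarith

theorem isUnit_and_condInfty_le (h : IsPosSymmDiagDominant A m l δ) (hn : 3 ≤ n) :
    IsUnit A ∧ condInfty A ≤ ((2 * m * ((n : ℝ) - 1) + δ) * (3 * (n : ℝ) - 4)) /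
      (2 * l * ((n : ℝ) - 2) * ((n : ℝ) - 1)) := by
  have h3 : (3 : ℝ) ≤ n := by exact_mod_cast hn
  have hl := h.smallest_pos
  have hc : 0 < sharpConst n * l := mul_pos (sharpConst_pos hn) hl
  have hA := sharpConst_mul_le_of_abs_mulVec_le hn hl.le h.symm
    (fun i j => h.smallest_entry.2 ⟨i, j, rfl⟩) h.diagDominant
  refine ⟨isUnit_of_mul_norm_le hc hA, ?_⟩
  have h1 := h.normInfty_le (by omega)
  refine (mul_le_mul h1 (normInfty_inv_le hc hA) (normInfty_nonneg _)
    ((normInfty_nonneg _).trans h1)).trans_eq ?_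
  have e1 : (n : ℝ) - 1 ≠ 0 := by linarith
  have e2 : (n : ℝ) - 2 ≠ 0 := by linarith
  have e3 : 3 * (n : ℝ) - 4 ≠ 0 := by linarith
  rw [sharpConst]
  field_simp

end IsPosSymmDiagDominant

theorem tendsto_condBound (m l δ : ℝ) (hl : 0 < l) :
    Tendsto (fun n : ℕ => ((2 * m * ((n : ℝ) - 1) + δ) * (3 * (n : ℝ) - 4)) /
      (2 * l * ((n : ℝ) - 2) * ((n : ℝ) - 1))) atTop (𝓝 (3 * m / l)) := by
  have hinv : ∀ a : ℝ, Tendsto (fun n : ℕ => ((n : ℝ) - a)⁻¹) atTop (𝓝 0) := fun a =>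
    tendsto_inv_atTop_zero.comp
      (tendsto_atTop_add_const_right _ (-a) tendsto_natCast_atTop_atTop)
  -- `(3n - 4)/(n - 2) = 3 + 2/(n - 2)` and `(2m(n - 1) + δ)/(n - 1) = 2m + δ/(n - 1)`
  have hlim : Tendsto (fun n : ℕ => (2 * m + δ * ((n : ℝ) - 1)⁻¹) *
      (3 + 2 * ((n : ℝ) - 2)⁻¹) / (2 * l)) atTop (𝓝 ((2 * m + δ * 0) * (3 + 2 * 0) / (2 * l))) :=
    ((((hinv 1).const_mul δ).const_add _).mul (((hinv 2).const_mul 2).const_add _)).div_const _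
  have he : (2 * m + δ * 0) * (3 + 2 * 0) / (2 * l) = 3 * m / l := by
    field_simp
    ring
  rw [he] at hlim
  refine hlim.congr' ?_
  filter_upwards [eventually_ge_atTop 3] with n hn
  have h3 : (3 : ℝ) ≤ n := by exact_mod_cast hn
  have e1 : (n : ℝ) - 1 ≠ 0 := by linarith
  have e2 : (n : ℝ) - 2 ≠ 0 := by linarith
  field_simp
  ring

end DiagDominant

theorem mainTheorem6 :
    -- invertibility and the bound on the condition number
    (∀ (n : ℕ) (A : Matrix (Fin n) (Fin n) ℝ) (m l δ : ℝ), 3 ≤ n →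
      DiagDominant.IsPosSymmDiagDominant A m l δ →
        IsUnit A ∧
        DiagDominant.condInfty A ≤
          ((2 * m * ((n : ℝ) - 1) + δ) * (3 * (n : ℝ) - 4)) /
            (2 * l * ((n : ℝ) - 2) * ((n : ℝ) - 1))) ∧
    -- for fixed parameters the bound tends to `3m/l`
    (∀ m l δ : ℝ, 0 < l →
      Tendsto (fun n : ℕ =>
          ((2 * m * ((n : ℝ) - 1) + δ) * (3 * (n : ℝ) - 4)) /
            (2 * l * ((n : ℝ) - 2) * ((n : ℝ) - 1)))
        atTop (𝓝 (3 * m / l))) ∧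
    -- the condition number is asymptotically at most `3m/l`, uniformly while `δ/m` is bounded
    (∀ D ε : ℝ, 0 < ε → ∃ N : ℕ, ∀ (n : ℕ) (A : Matrix (Fin n) (Fin n) ℝ) (m l δ : ℝ), N ≤ n →
      DiagDominant.IsPosSymmDiagDominant A m l δ → δ ≤ D * m →
        DiagDominant.condInfty A ≤ (1 + ε) * (3 * m / l)) := by
  refine ⟨fun n A m l δ hn h => h.isUnit_and_condInfty_le hn,
    DiagDominant.tendsto_condBound, fun D ε hε => ?_⟩
  -- The bound is increasing in `δ` and homogeneous in `(m, δ)` and `1 / l`, so the limit at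
  -- `m = l = 1`, `δ = D` covers all matrices with `δ ≤ D m` at once.
  have hlt : 3 * (1 : ℝ) / 1 < 3 * (1 + ε) := by linarith
  obtain ⟨N, hN⟩ := eventually_atTop.1
    ((DiagDominant.tendsto_condBound 1 1 D one_pos).eventually_le_const hlt)
  refine ⟨max N 3, fun n A m l δ hn h hδ => ?_⟩
  have hn3 : 3 ≤ n := (le_max_right _ _).trans hn
  have h3 : (3 : ℝ) ≤ n := by exact_mod_cast hn3
  have hl := h.smallest_pos
  have hm := h.largest_pos
  have e1 : 0 < (n : ℝ) - 1 := by linarith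
  have e2 : 0 < (n : ℝ) - 2 := by linarith
  have e3 : 0 < 3 * (n : ℝ) - 4 := by linarith
  calc DiagDominant.condInfty A
      ≤ ((2 * m * ((n : ℝ) - 1) + δ) * (3 * (n : ℝ) - 4)) /
          (2 * l * ((n : ℝ) - 2) * ((n : ℝ) - 1)) := (h.isUnit_and_condInfty_le hn3).2
    _ ≤ ((2 * m * ((n : ℝ) - 1) + D * m) * (3 * (n : ℝ) - 4)) /
          (2 * l * ((n : ℝ) - 2) * ((n : ℝ) - 1)) := by gcongr
    _ = m / l * (((2 * 1 * ((n : ℝ) - 1) + D) * (3 * (n : ℝ) - 4)) /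
          (2 * 1 * ((n : ℝ) - 2) * ((n : ℝ) - 1))) := by
        field_simp
    _ ≤ m / l * (3 * (1 + ε)) :=
        mul_le_mul_of_nonneg_left (hN n ((le_max_left _ _).trans hn)) (by positivity)
    _ = (1 + ε) * (3 * m / l) := by ring
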